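/- Let $n\ge 1$, let $\Omega\subset\mathbb{R}^n$ be a bounded domain (nonempty, open, connected) with Lipschitz boundary, and let $\mathcal M\subset\mathbb R^n$ be a smooth embedded $(n-1)$-dimensional submanifold which divides $\Omega$ into two Lipschitz subdomains: $\Omega\setminus\mathcal M=\Omega_+\cup\Omega_-$ with $\Omega_\pm$ disjoint bounded Lipschitz domains. Let $\mu$ be the $(n-1)$-dimensional surface measure; functions in $H^1(\Omega)$ are evaluated on $\partial\Omega$ and on $\mathcal M\cap\Omega$ in the sense of traces, integrals over $\mathcal M$ and the space $L^2(\mathcal M)$ refer to $\mathcal M\cap\Omega$, and $\|\cdot\|_\Omega$ is the norm of $L^2(\Omega,\mathbb R^n)$. Let $H^1_0(\Omega)$ be the set of functions in $H^1(\Omega)$ vanishing on $\partial\Omega$. Let $\varphi\in H^{1/2}(\partial\Omega)$ (that is, $\varphi$ is the trace of a function in $H^1(\Omega)$), let $\psi:\mathcal M\to\mathbb R$ be smooth, and put $$\mathbb K=\{v\in H^1(\Omega):\ v\ge\psi \text{ a.e. on }\mathcal M\cap\Omega,\ v=\varphi \text{ on }\partial\Omega\}.$$ Let $u\in\mathbb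 K$ be a minimizer of $J(v)=\frac12\int_\Omega|\nabla v|^2dx$ over $\mathbb K$. For $\lambda\in\Lambda:=\{\lambda\in L^2(\mathcal M):\lambda\ge0\text{ a.e.}\}$ let $$Q^*_{\lambda,\mathcal M}=\Big\{y^*\in L^2(\Omega,\mathbb R^n):\ \int_\Omega y^*\cdot\nabla w\,dx=\int_{\mathcal M}\lambda w\,d\mu\quad\forall w\in H^1_0(\Omega)\Big\}.$$ Then for every $v\in\mathbb K$, every $\lambda\in\Lambda$ and every $y^*\in Q^*_{\lambda,\mathcal M}$, $$\|\nabla(v-u)\|_\Omega^2\le\|\nabla v-y^*\|_\Omega^2+2\int_{\mathcal M}\lambda(v-\psi)\,d\mu .$$ Here the integral of the a.e. nonnegative function $\lambda(v-\psi)$ is understood with values in $[0,\infty]$; if $\psi\in L^2(\mathcal M)$ (for instance, if $\psi$ is bounded on $\mathcal M\cap\Omega$), then $\lambda(v-\psi)$ is integrable and the estimate holds between real numbers. -/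

import Mathlib

open MeasureTheory Set Filter Topology
open scoped ENNReal NNReal ContDiff

noncomputable section

namespace ThinObstacle

/-- Euclidean space `ℝⁿ`. -/
abbrev E (n : ℕ) : Type := EuclideanSpace ℝ (Fin n)

/-- The `(n-1)`-dimensional surface measure on `S ⊆ ℝⁿ` (Hausdorff measure, normalized to agree
with the usual area), extended by zero outside `S`. -/
def surf {n : ℕ} (S : Set (E n)) : Measure (E n) := (μHE[n - 1] : Measure (E n)).restrict S

/-! ### Geometry -/

/-- Bounded Lipschitz domain: nonempty, open, connected, bounded, and near each boundary point, in
a suitable orthonormal frame with "vertical" unit vector `e`, it is the set of points strictly above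
the graph of a Lipschitz function of the "horizontal" component `y - ⟪e, y⟫ e`. -/
structure IsLipschitzDomain {n : ℕ} (Ω : Set (E n)) : Prop where
  isOpen : IsOpen Ω
  isConnected : IsConnected Ω
  isBounded : Bornology.IsBounded Ω
  lipschitz_boundary : ∀ x ∈ frontier Ω, ∃ e : E n, ‖e‖ = 1 ∧
    ∃ γ : E n → ℝ, (∃ C : ℝ≥0, LipschitzWith C γ) ∧
      ∃ U ∈ 𝓝 x, ∀ y ∈ U, y ∈ Ω ↔ γ (y - inner ℝ e y • e) < inner ℝ e y

/-- Smooth `(n-1)`-dimensional (embedded) submanifold of `ℝⁿ`: locally a regular level set of a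
smooth function. -/
def IsSmoothHypersurface {n : ℕ} (M : Set (E n)) : Prop :=
  ∀ x ∈ M, ∃ U : Set (E n), IsOpen U ∧ x ∈ U ∧ ∃ F : E n → ℝ, ContDiffOn ℝ ∞ F U ∧
    (∀ y ∈ U, fderiv ℝ F y ≠ 0) ∧ M ∩ U = {y ∈ U | F y = 0}

/-- `M` divides `Ω` into two Lipschitz subdomains `Ω₊` and `Ω₋`. -/
def DividesIntoLipschitz {n : ℕ} (M Ω : Set (E n)) : Prop :=
  ∃ Ωp Ωm : Set (E n), IsLipschitzDomain Ωp ∧ IsLipschitzDomain Ωm ∧ Disjoint Ωp Ωm ∧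
    Ω \ M = Ωp ∪ Ωm

/-! ### Sobolev spaces and traces

Functions and vector fields on `Ω` are represented by functions on `ℝⁿ`, of which only the values
on `Ω` (up to Lebesgue null sets) matter; likewise for functions on surfaces. -/

/-- Membership in `L²(Ω, F)`. -/
def MemL2 {n : ℕ} {F : Type*} [NormedAddCommGroup F] (Ω : Set (E n)) (f : E n → F) : Prop :=
  MemLp f 2 (volume.restrict Ω)

/-- `G` is the weak gradient of `v` on `Ω`, tested with all `η ∈ C_c^∞(Ω)`
(meaningful for locally integrable `v` and `G`; used below for `L²` only). -/
def HasWeakGrad {n : ℕ} (Ω : Set (E n)) (v : E n → ℝ) (G : E n → E n) : Prop :=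
  ∀ η : E n → ℝ, ContDiff ℝ ∞ η → HasCompactSupport η → tsupport η ⊆ Ω → ∀ e : E n,
    ∫ x in Ω, v x * fderiv ℝ η x e = -∫ x in Ω, inner ℝ (G x) e * η x

/-- Membership in `H¹(Ω)`. -/
def MemH1 {n : ℕ} (Ω : Set (E n)) (v : E n → ℝ) : Prop :=
  MemL2 Ω v ∧ ∃ G : E n → E n, MemL2 Ω G ∧ HasWeakGrad Ω v G

open Classical in
/-- The weak gradient `∇v` of `v ∈ H¹(Ω)`, determined up to null sets of `Ω`. -/
def weakGrad {n : ℕ} (Ω : Set (E n)) (v : E n → ℝ) : E n → E n :=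
  if h : ∃ G : E n → E n, MemL2 Ω G ∧ HasWeakGrad Ω v G then h.choose else 0

/-- `‖F‖²_Ω`, the squared norm of a field in `L²(Ω, ℝⁿ)`. -/
def normSq {n : ℕ} (Ω : Set (E n)) (F : E n → E n) : ℝ := ∫ x in Ω, ‖F x‖ ^ 2

/-- `g ∈ L²(S)` is the trace of `v ∈ H¹(Ω)` on the surface `S ⊆ closure Ω`: the trace operator is the
extension, by continuity from `H¹(Ω)` to `L²(S)`, of the restriction map `f ↦ f|_S` on functions
smooth up to the boundary, i.e. its graph is the closure of the graph of the restriction map. -/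
def IsTrace {n : ℕ} (Ω S : Set (E n)) (v g : E n → ℝ) : Prop :=
  MemLp g 2 (surf S) ∧
    ∃ f : ℕ → E n → ℝ, (∀ k, ContDiff ℝ ∞ (f k)) ∧
      Tendsto (fun k => eLpNorm (f k - v) 2 (volume.restrict Ω)) atTop (𝓝 0) ∧
      Tendsto (fun k => eLpNorm (gradient (f k) - weakGrad Ω v) 2 (volume.restrict Ω))
        atTop (𝓝 0) ∧
      Tendsto (fun k => eLpNorm (f k - g) 2 (surf S)) atTop (𝓝 0)

/-- Membership in `H¹₀(Ω)`: the functions in `H¹(Ω)` vanishing on `∂Ω` (in the sense of traces). -/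
def MemH10 {n : ℕ} (Ω : Set (E n)) (w : E n → ℝ) : Prop :=
  MemH1 Ω w ∧ IsTrace Ω (frontier Ω) w 0

/-- Membership in `H^{1/2}(∂Ω)`, the space of boundary traces of `H¹(Ω)` functions. -/
def MemHHalf {n : ℕ} (Ω : Set (E n)) (φ : E n → ℝ) : Prop :=
  ∃ w : E n → ℝ, MemH1 Ω w ∧ IsTrace Ω (frontier Ω) w φ

/-! ### The thin obstacle problem -/

/-- The Dirichlet energy `J(v) = ½ ∫_Ω |∇v|²`. -/
def energy {n : ℕ} (Ω : Set (E n)) (v : E n → ℝ) : ℝ := (1 / 2) * normSq Ω (weakGrad Ω v)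

/-- The convex set `𝕂` of all `v ∈ H¹(Ω)` with `v = φ` on `∂Ω` and `v ≥ ψ` on `M ∩ Ω`
(both in the sense of traces, almost everywhere for the surface measure). -/
def admissible {n : ℕ} (Ω M : Set (E n)) (φ ψ : E n → ℝ) : Set (E n → ℝ) :=
  {v | MemH1 Ω v ∧ IsTrace Ω (frontier Ω) v φ ∧
    ∃ g, IsTrace Ω (M ∩ Ω) v g ∧ ψ ≤ᵐ[surf (M ∩ Ω)] g}

/-- `u` minimizes the Dirichlet energy over `𝕂`. -/
def IsMinimizer {n : ℕ} (Ω M : Set (E n)) (φ ψ u : E n → ℝ) : Prop :=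
  u ∈ admissible Ω M φ ψ ∧ ∀ v ∈ admissible Ω M φ ψ, energy Ω u ≤ energy Ω v

/-- The cone `Λ` of almost everywhere nonnegative functions in `L²(M)` (on the part of `M` in `Ω`). -/
def multipliers {n : ℕ} (Ω M : Set (E n)) : Set (E n → ℝ) :=
  {lam | MemLp lam 2 (surf (M ∩ Ω)) ∧ 0 ≤ᵐ[surf (M ∩ Ω)] lam}

/-- The set `Q*_{λ,M}` of fields `y ∈ L²(Ω, ℝⁿ)` with `∫_Ω y · ∇w = ∫_M λ w dμ` for all
`w ∈ H¹₀(Ω)`; on the right, `w` on `M` is the trace `g` of `w`. -/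
def dualFields {n : ℕ} (Ω M : Set (E n)) (lam : E n → ℝ) : Set (E n → E n) :=
  {y | MemL2 Ω y ∧ ∀ w g : E n → ℝ, MemH10 Ω w → IsTrace Ω (M ∩ Ω) w g →
    ∫ x in Ω, inner ℝ (y x) (weakGrad Ω w x) = ∫ x, lam x * g x ∂(surf (M ∩ Ω))}

end ThinObstacle

end

namespace ThinObstacle

variable {n : ℕ} {Ω S M : Set (E n)}

/-! Two facts carry the estimate. Since 𝕂 is convex (`admissible_convex_comb`), comparing `u` with
points of the segment towards `v` gives `‖∇u‖² ≤ ∫ ∇u · ∇v` (`IsMinimizer.variational_inequality`).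
Since `v - u` lies in `H¹₀`, it may be tested against `y`, which gives `∫ y · ∇(v - u) = ∫ λ (g -
gu)` with `g`, `gu` the traces on `M ∩ Ω`. Expanding squares, `‖∇v - y‖² + 2 ∫ λ (g - gu) - ‖∇(v -
u)‖² = ‖∇u - y‖² + 2 (∫ ∇u · ∇v - ‖∇u‖²) ≥ 0`. Finally `gu ≥ ψ` and `λ ≥ 0` allow `gu` to be
replaced by `ψ`. The preliminary lemmas supply linearity of weak gradients and traces. -/

theorem memLp_two_of_hasCompactSupport {μ : Measure (E n)} [IsFiniteMeasureOnCompacts μ]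
    {η : E n → ℝ} (hη : Continuous η) (hc : HasCompactSupport η) : MemLp η 2 μ :=
  hη.memLp_of_hasCompactSupport hc

theorem memLp_fderiv_apply {μ : Measure (E n)} [IsFiniteMeasureOnCompacts μ]
    {η : E n → ℝ} (hη : ContDiff ℝ ∞ η) (hc : HasCompactSupport η) (e : E n) :
    MemLp (fun x => fderiv ℝ η x e) 2 μ := by
  refine memLp_two_of_hasCompactSupport ?_ (hc.fderiv_apply (𝕜 := ℝ) e)
  exact (hη.continuous_fderiv (by simp)).clm_apply continuous_const

/-! ### Linearity and uniqueness of weak gradients -/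

theorem HasWeakGrad.linear_comb {v w : E n → ℝ} {G H : E n → E n} (a b : ℝ)
    (hv : MemL2 Ω v) (hw : MemL2 Ω w) (hG : MemL2 Ω G) (hH : MemL2 Ω H)
    (hvG : HasWeakGrad Ω v G) (hwH : HasWeakGrad Ω w H) :
    HasWeakGrad Ω (a • v + b • w) (a • G + b • H) := by
  intro η hη hc hs e
  have hd := memLp_fderiv_apply (μ := volume.restrict Ω) hη hc e
  have hη2 := memLp_two_of_hasCompactSupport (μ := volume.restrict Ω) hη.continuous hc
  have iv : Integrable (fun x => v x * fderiv ℝ η x e) (volume.restrict Ω) := hv.integrable_mul hd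
  have iw : Integrable (fun x => w x * fderiv ℝ η x e) (volume.restrict Ω) := hw.integrable_mul hd
  have iG : Integrable (fun x => inner ℝ (G x) e * η x) (volume.restrict Ω) :=
    (hG.inner_const e).integrable_mul hη2
  have iH : Integrable (fun x => inner ℝ (H x) e * η x) (volume.restrict Ω) :=
    (hH.inner_const e).integrable_mul hη2
  have e1 : ∀ x, (a • v + b • w) x * fderiv ℝ η x e =
      a * (v x * fderiv ℝ η x e) + b * (w x * fderiv ℝ η x e) := fun x => by
    simp only [Pi.add_apply, Pi.smul_apply, smul_eq_mul]; ring
  have e2 : ∀ x, inner ℝ ((a • G + b • H) x) e * η x =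
      a * (inner ℝ (G x) e * η x) + b * (inner ℝ (H x) e * η x) := fun x => by
    simp only [Pi.add_apply, Pi.smul_apply, inner_add_left, real_inner_smul_left]; ring
  simp only [e1, e2]
  rw [integral_add (iv.const_mul a) (iw.const_mul b), integral_add (iG.const_mul a) (iH.const_mul b)]
  simp only [integral_const_mul, hvG η hη hc hs e, hwH η hη hc hs e]
  ring

theorem HasWeakGrad.ae_unique {v : E n → ℝ} {G H : E n → E n} (hΩ : IsOpen Ω)
    (hG : MemL2 Ω G) (hH : MemL2 Ω H)
    (hvG : HasWeakGrad Ω v G) (hvH : HasWeakGrad Ω v H) : G =ᵐ[volume.restrict Ω] H := by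
  have hD : MemLp (G - H) 2 (volume.restrict Ω) := hG.sub hH
  have key := hΩ.ae_eq_zero_of_integral_contDiff_smul_eq_zero (μ := volume.restrict Ω)
    ((hD.locallyIntegrable (by norm_num)).locallyIntegrableOn Ω) (fun η hη hc hs => by
      have hη2 := memLp_two_of_hasCompactSupport (μ := volume.restrict Ω) hη.continuous hc
      have iD : Integrable (fun x => η x • (G - H) x) (volume.restrict Ω) := memLp_one_iff_integrable.1 (hD.smul hη2)
      -- Pairing with an arbitrary `e` reduces the vector integral to the scalar identities defining
      -- the weak gradient.
      refine ext_inner_left ℝ fun e => ?_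
      rw [← integral_inner iD, inner_zero_right]
      have h1 := (hvG η hη hc hs e).symm.trans (hvH η hη hc hs e)
      have iG : Integrable (fun x => inner ℝ (G x) e * η x) (volume.restrict Ω) :=
        (hG.inner_const e).integrable_mul hη2
      have iH : Integrable (fun x => inner ℝ (H x) e * η x) (volume.restrict Ω) :=
        (hH.inner_const e).integrable_mul hη2
      have e1 : ∀ x, inner ℝ e (η x • (G - H) x) =
          inner ℝ (G x) e * η x - inner ℝ (H x) e * η x := fun x => by
        rw [real_inner_smul_right, Pi.sub_apply, inner_sub_right, real_inner_comm,
          real_inner_comm e (H x)]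
        ring
      simp only [e1]
      rw [integral_sub iG iH]
      linarith)
  filter_upwards [key, ae_restrict_mem hΩ.measurableSet] with x hx hxΩ
  exact sub_eq_zero.mp (hx hxΩ)

theorem MemH1.weakGrad_spec {v : E n → ℝ} (hv : MemH1 Ω v) :
    MemL2 Ω (weakGrad Ω v) ∧ HasWeakGrad Ω v (weakGrad Ω v) := by
  rw [weakGrad, dif_pos hv.2]
  exact hv.2.choose_spec

theorem MemH1.linear_comb {v w : E n → ℝ} (hv : MemH1 Ω v) (hw : MemH1 Ω w) (a b : ℝ) :
    MemH1 Ω (a • v + b • w) :=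
  ⟨(hv.1.const_smul a).add (hw.1.const_smul b), _,
    (hv.weakGrad_spec.1.const_smul a).add (hw.weakGrad_spec.1.const_smul b),
    .linear_comb a b hv.1 hw.1 hv.weakGrad_spec.1 hw.weakGrad_spec.1
      hv.weakGrad_spec.2 hw.weakGrad_spec.2⟩

/-- `weakGrad` is an arbitrary choice of representative, so linearity holds only almost everywhere
and comes from uniqueness. -/
theorem weakGrad_linear_comb {v w : E n → ℝ} (hΩ : IsOpen Ω) (hv : MemH1 Ω v) (hw : MemH1 Ω w)
    (a b : ℝ) : weakGrad Ω (a • v + b • w) =ᵐ[volume.restrict Ω]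
      a • weakGrad Ω v + b • weakGrad Ω w :=
  HasWeakGrad.ae_unique hΩ (hv.linear_comb hw a b).weakGrad_spec.1
    ((hv.weakGrad_spec.1.const_smul a).add (hw.weakGrad_spec.1.const_smul b))
    (hv.linear_comb hw a b).weakGrad_spec.2
    (.linear_comb a b hv.1 hw.1 hv.weakGrad_spec.1 hw.weakGrad_spec.1
      hv.weakGrad_spec.2 hw.weakGrad_spec.2)

/-! ### Linearity of traces and convexity of 𝕂 -/

theorem tendsto_eLpNorm_linear_comb {α F : Type*} [MeasurableSpace α] [NormedAddCommGroup F]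
    [NormedSpace ℝ F] {μ : Measure α} {f₁ f₂ : ℕ → α → F} {g₁ g₂ : α → F} (a b : ℝ)
    (hf₁ : ∀ k, AEStronglyMeasurable (f₁ k) μ) (hf₂ : ∀ k, AEStronglyMeasurable (f₂ k) μ)
    (hg₁ : AEStronglyMeasurable g₁ μ) (hg₂ : AEStronglyMeasurable g₂ μ)
    (h₁ : Tendsto (fun k => eLpNorm (f₁ k - g₁) 2 μ) atTop (𝓝 0))
    (h₂ : Tendsto (fun k => eLpNorm (f₂ k - g₂) 2 μ) atTop (𝓝 0)) :
    Tendsto (fun k => eLpNorm (a • f₁ k + b • f₂ k - (a • g₁ + b • g₂)) 2 μ) atTop (𝓝 0) := by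
  have hlim : Tendsto (fun k => ‖a‖ₑ * eLpNorm (f₁ k - g₁) 2 μ + ‖b‖ₑ * eLpNorm (f₂ k - g₂) 2 μ)
      atTop (𝓝 0) := by
    simpa using (ENNReal.Tendsto.const_mul h₁ (.inr (enorm_ne_top (x := a)))).add
      (ENNReal.Tendsto.const_mul h₂ (.inr (enorm_ne_top (x := b))))
  refine tendsto_of_tendsto_of_tendsto_of_le_of_le tendsto_const_nhds hlim (fun _ => zero_le)
    fun k => ?_
  have e : a • f₁ k + b • f₂ k - (a • g₁ + b • g₂) = a • (f₁ k - g₁) + b • (f₂ k - g₂) := by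
    rw [smul_sub, smul_sub]; abel
  dsimp only
  rw [e, ← eLpNorm_const_smul, ← eLpNorm_const_smul]
  exact eLpNorm_add_le (((hf₁ k).sub hg₁).const_smul a) (((hf₂ k).sub hg₂).const_smul b)
    (by norm_num)

theorem continuous_gradient {f : E n → ℝ} (hf : ContDiff ℝ ∞ f) : Continuous (gradient f) :=
  (InnerProductSpace.toDual ℝ (E n)).symm.continuous.comp (hf.continuous_fderiv (by simp))

theorem gradient_linear_comb {f₁ f₂ : E n → ℝ} (h₁ : ContDiff ℝ ∞ f₁) (h₂ : ContDiff ℝ ∞ f₂)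
    (a b : ℝ) : gradient (a • f₁ + b • f₂) = a • gradient f₁ + b • gradient f₂ := by
  funext x
  have d₁ : DifferentiableAt ℝ f₁ x := h₁.differentiable (by simp) x
  have d₂ : DifferentiableAt ℝ f₂ x := h₂.differentiable (by simp) x
  simp only [gradient, Pi.add_apply, Pi.smul_apply]
  rw [fderiv_add (d₁.const_smul a) (d₂.const_smul b), fderiv_const_smul d₁, fderiv_const_smul d₂]
  simp

/-- The same combination of the two smooth approximating sequences works, by the triangle inequality
in each of the three norms. -/
theorem IsTrace.linear_comb {v w g h : E n → ℝ} (hΩ : IsOpen Ω) (hv : MemH1 Ω v) (hw : MemH1 Ω w)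
    (hvg : IsTrace Ω S v g) (hwh : IsTrace Ω S w h) (a b : ℝ) :
    IsTrace Ω S (a • v + b • w) (a • g + b • h) := by
  obtain ⟨hg, f₁, c₁, v₁, G₁, t₁⟩ := hvg
  obtain ⟨hh, f₂, c₂, v₂, G₂, t₂⟩ := hwh
  refine ⟨(hg.const_smul a).add (hh.const_smul b), fun k => a • f₁ k + b • f₂ k,
    fun k => ((c₁ k).const_smul a).add ((c₂ k).const_smul b), ?_, ?_, ?_⟩
  · exact tendsto_eLpNorm_linear_comb a b (fun k => (c₁ k).continuous.aestronglyMeasurable)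
      (fun k => (c₂ k).continuous.aestronglyMeasurable) hv.1.1 hw.1.1 v₁ v₂
  · have := tendsto_eLpNorm_linear_comb a b
      (fun k => (continuous_gradient (c₁ k)).aestronglyMeasurable)
      (fun k => (continuous_gradient (c₂ k)).aestronglyMeasurable)
      hv.weakGrad_spec.1.1 hw.weakGrad_spec.1.1 G₁ G₂
    refine this.congr fun k => eLpNorm_congr_ae ?_
    rw [gradient_linear_comb (c₁ k) (c₂ k)]
    exact (EventuallyEq.refl _ _).sub (weakGrad_linear_comb hΩ hv hw a b).symm
  · exact tendsto_eLpNorm_linear_comb a b (fun k => (c₁ k).continuous.aestronglyMeasurable)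
      (fun k => (c₂ k).continuous.aestronglyMeasurable) hg.1 hh.1 t₁ t₂

theorem admissible_convex_comb {φ ψ u v : E n → ℝ} (hΩ : IsOpen Ω)
    (hu : u ∈ admissible Ω M φ ψ) (hv : v ∈ admissible Ω M φ ψ) {a b : ℝ} (ha : 0 ≤ a)
    (hb : 0 ≤ b) (hab : a + b = 1) : a • u + b • v ∈ admissible Ω M φ ψ := by
  obtain ⟨hu1, huφ, gu, hgu, hψu⟩ := hu
  obtain ⟨hv1, hvφ, gv, hgv, hψv⟩ := hv
  refine ⟨hu1.linear_comb hv1 a b, ?_, _, hgu.linear_comb hΩ hu1 hv1 hgv a b, ?_⟩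
  · have h := huφ.linear_comb hΩ hu1 hv1 hvφ a b
    -- `a + b = 1` preserves the boundary datum `φ`, and below also the obstacle `ψ`.
    rwa [← add_smul, hab, one_smul] at h
  · filter_upwards [hψu, hψv] with x h₁ h₂
    simp only [Pi.add_apply, Pi.smul_apply, smul_eq_mul]
    calc ψ x = a * ψ x + b * ψ x := by rw [← add_mul, hab, one_mul]
      _ ≤ a * gu x + b * gv x := by gcongr

/-! ### Quadratic expansions and the error estimate -/

theorem normSq_congr {F G : E n → E n} (h : F =ᵐ[volume.restrict Ω] G) :
    normSq Ω F = normSq Ω G :=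
  integral_congr_ae (h.fun_comp fun z => ‖z‖ ^ 2)

theorem normSq_nonneg (F : E n → E n) : 0 ≤ normSq Ω F :=
  integral_nonneg fun _ => sq_nonneg _

theorem integrable_inner_of_memLp {F G : E n → E n} (hF : MemL2 Ω F) (hG : MemL2 Ω G) :
    Integrable (fun x => inner ℝ (F x) (G x)) (volume.restrict Ω) := by
  refine (hF.norm.integrable_mul hG.norm).mono (hF.1.inner hG.1) (.of_forall fun x => ?_)
  simpa using norm_inner_le_norm (𝕜 := ℝ) (F x) (G x)

theorem normSq_linear_comb {F G : E n → E n} (hF : MemL2 Ω F) (hG : MemL2 Ω G) (a b : ℝ) :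
    normSq Ω (a • F + b • G) =
      a ^ 2 * normSq Ω F + 2 * a * b * (∫ x in Ω, inner ℝ (F x) (G x)) + b ^ 2 * normSq Ω G := by
  have iF : Integrable (fun x => ‖F x‖ ^ 2) (volume.restrict Ω) := hF.integrable_norm_pow (by simp)
  have iG : Integrable (fun x => ‖G x‖ ^ 2) (volume.restrict Ω) := hG.integrable_norm_pow (by simp)
  have iFG : Integrable (fun x => inner ℝ (F x) (G x)) (volume.restrict Ω) := integrable_inner_of_memLp hF hG
  have e : ∀ x, ‖(a • F + b • G) x‖ ^ 2 =
      a ^ 2 * ‖F x‖ ^ 2 + 2 * a * b * inner ℝ (F x) (G x) + b ^ 2 * ‖G x‖ ^ 2 := fun x => by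
    simp only [Pi.add_apply, Pi.smul_apply]
    rw [norm_add_sq_real, norm_smul, norm_smul, real_inner_smul_left, real_inner_smul_right,
      mul_pow, mul_pow, Real.norm_eq_abs, Real.norm_eq_abs, sq_abs, sq_abs]
    ring
  unfold normSq
  simp only [e]
  have i₁ : Integrable (fun x => a ^ 2 * ‖F x‖ ^ 2 + 2 * a * b * inner ℝ (F x) (G x))
      (volume.restrict Ω) := (iF.const_mul _).add (iFG.const_mul _)
  rw [integral_add i₁ (iG.const_mul _), integral_add (iF.const_mul _) (iFG.const_mul _)]
  simp only [integral_const_mul]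

/-- The variational inequality `∫ ∇u · ∇(v - u) ≥ 0` for the minimizer. -/
theorem IsMinimizer.variational_inequality {φ ψ u v : E n → ℝ} (hΩ : IsOpen Ω)
    (hu : IsMinimizer Ω M φ ψ u) (hv : v ∈ admissible Ω M φ ψ) :
    normSq Ω (weakGrad Ω u) ≤ ∫ x in Ω, inner ℝ (weakGrad Ω u x) (weakGrad Ω v x) := by
  have hu1 := hu.1.1
  have hv1 := hv.1
  have key : ∀ t : ℝ, 0 ≤ t → t ≤ 1 → normSq Ω (weakGrad Ω u) ≤
      (1 - t) ^ 2 * normSq Ω (weakGrad Ω u) +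
        2 * (1 - t) * t * (∫ x in Ω, inner ℝ (weakGrad Ω u x) (weakGrad Ω v x)) +
        t ^ 2 * normSq Ω (weakGrad Ω v) := by
    intro t h0 h1
    have h := hu.2 _ (admissible_convex_comb hΩ hu.1 hv (sub_nonneg.2 h1) h0 (by ring))
    rw [energy, energy, normSq_congr (weakGrad_linear_comb hΩ hu1 hv1 _ _),
      normSq_linear_comb hu1.weakGrad_spec.1 hv1.weakGrad_spec.1] at h
    linarith
  generalize normSq Ω (weakGrad Ω u) = A at *
  generalize (∫ x in Ω, inner ℝ (weakGrad Ω u x) (weakGrad Ω v x)) = B at *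
  have hC := normSq_nonneg (Ω := Ω) (weakGrad Ω v)
  generalize normSq Ω (weakGrad Ω v) = C at *
  -- Since `1 - (1 - t)² = t (2 - t)`, `key` divided by `t > 0` reads `(2 - t) A ≤ 2 (1 - t) B + t
  -- C`; let `t → 0⁺`.
  have hlim : Tendsto (fun t : ℝ => (2 - t) * A) (𝓝[>] 0) (𝓝 (2 * A)) := by
    have : Continuous fun t : ℝ => (2 - t) * A := by fun_prop
    simpa using (this.tendsto 0).mono_left nhdsWithin_le_nhds
  have hlim' : Tendsto (fun t : ℝ => 2 * (1 - t) * B + t * C) (𝓝[>] 0) (𝓝 (2 * B)) := by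
    have : Continuous fun t : ℝ => 2 * (1 - t) * B + t * C := by fun_prop
    simpa using (this.tendsto 0).mono_left nhdsWithin_le_nhds
  have h2 : 2 * A ≤ 2 * B := by
    refine le_of_tendsto_of_tendsto hlim hlim' ?_
    filter_upwards [Ioc_mem_nhdsGT (zero_lt_one' ℝ)] with t ht
    refine le_of_mul_le_mul_left ?_ ht.1
    nlinarith [key t ht.1.le ht.2]
  linarith

/-- The error estimate in terms of the trace `gu` of the minimizer, before `gu ≥ ψ` is used. -/
theorem IsMinimizer.normSq_weakGrad_sub_le {φ ψ u v g gu lam : E n → ℝ} {y : E n → E n}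
    (hΩ : IsOpen Ω) (hu : IsMinimizer Ω M φ ψ u) (hv : v ∈ admissible Ω M φ ψ)
    (hg : IsTrace Ω (M ∩ Ω) v g) (hgu : IsTrace Ω (M ∩ Ω) u gu)
    (hy : y ∈ dualFields Ω M lam) :
    normSq Ω (weakGrad Ω (v - u)) ≤ normSq Ω (weakGrad Ω v - y) +
      2 * ∫ x, lam x * (g x - gu x) ∂(surf (M ∩ Ω)) := by
  have hu1 := hu.1.1
  have hv1 := hv.1
  have hGu := hu1.weakGrad_spec.1
  have hGv := hv1.weakGrad_spec.1
  have sub_eq : ∀ {F : Type} [AddCommGroup F] [Module ℝ F] (p q : E n → F),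
      p - q = (1 : ℝ) • p + (-1 : ℝ) • q := fun p q => by
    rw [one_smul, neg_one_smul, sub_eq_add_neg]
  have hgrad : weakGrad Ω (v - u) =ᵐ[volume.restrict Ω]
      (1 : ℝ) • weakGrad Ω v + (-1 : ℝ) • weakGrad Ω u := by
    rw [sub_eq v u]; exact weakGrad_linear_comb hΩ hv1 hu1 1 (-1)
  have hw : MemH10 Ω (v - u) := by
    rw [sub_eq v u]
    refine ⟨hv1.linear_comb hu1 1 (-1), ?_⟩
    have h := hv.2.1.linear_comb hΩ hv1 hu1 hu.1.2.1 1 (-1)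
    -- The common boundary values cancel, so `v - u` is a legitimate test function.
    rwa [← sub_eq φ φ, sub_self] at h
  have htr : IsTrace Ω (M ∩ Ω) (v - u) (g - gu) := by
    rw [sub_eq v u, sub_eq g gu]
    exact hg.linear_comb hΩ hv1 hu1 hgu 1 (-1)
  have hdual := hy.2 _ _ hw htr
  simp only [Pi.sub_apply] at hdual
  have iyv : Integrable (fun x => inner ℝ (y x) (weakGrad Ω v x)) (volume.restrict Ω) :=
    integrable_inner_of_memLp hy.1 hGv
  have iyu : Integrable (fun x => inner ℝ (y x) (weakGrad Ω u x)) (volume.restrict Ω) :=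
    integrable_inner_of_memLp hy.1 hGu
  have hsplit : ∫ x in Ω, inner ℝ (y x) (weakGrad Ω (v - u) x) =
      (∫ x in Ω, inner ℝ (y x) (weakGrad Ω v x)) - ∫ x in Ω, inner ℝ (y x) (weakGrad Ω u x) := by
    rw [← integral_sub iyv iyu]
    refine integral_congr_ae ?_
    filter_upwards [hgrad] with x hx
    rw [hx]
    simp [inner_add_right, sub_eq_add_neg]
  have hvi := hu.variational_inequality hΩ hv
  have hcomm : ∀ F G : E n → E n,
      ∫ x in Ω, inner ℝ (F x) (G x) = ∫ x in Ω, inner ℝ (G x) (F x) := fun F G =>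
    integral_congr_ae (.of_forall fun x => real_inner_comm _ _)
  have n1 := normSq_linear_comb hGv hGu 1 (-1)
  have n2 := normSq_linear_comb hGv hy.1 1 (-1)
  have n3 := normSq_linear_comb hGu hy.1 1 (-1)
  have n4 := normSq_nonneg (Ω := Ω) ((1 : ℝ) • weakGrad Ω u + (-1 : ℝ) • y)
  rw [normSq_congr hgrad, sub_eq (weakGrad Ω v) y]
  rw [hcomm (weakGrad Ω v) (weakGrad Ω u)] at n1
  rw [hcomm _ y] at n2 n3
  rw [← hdual, hsplit]
  linarith

end ThinObstacle

/-- Below, `g` is the trace of `v` on `M ∩ Ω`. The first part of the conclusion is the estimate in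
`[0, ∞]`, where the integral over `M` of the (a.e. nonnegative) function `λ (v - ψ)` may be infinite
if `ψ` is not square integrable on `M ∩ Ω`. The second part is the estimate between real numbers,
with convergence of the integral, when `ψ` is square integrable there. -/
theorem theorem2p1 {n : ℕ} (hn : 1 ≤ n) (Ω M : Set (ThinObstacle.E n))
    (hΩ : ThinObstacle.IsLipschitzDomain Ω)
    (hM : ThinObstacle.IsSmoothHypersurface M)
    (hdiv : ThinObstacle.DividesIntoLipschitz M Ω)
    (φ ψ : ThinObstacle.E n → ℝ)
    (hφ : ThinObstacle.MemHHalf Ω φ) (hψ : ContDiffOn ℝ ∞ ψ M)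
    (u : ThinObstacle.E n → ℝ) (hu : ThinObstacle.IsMinimizer Ω M φ ψ u)
    (v : ThinObstacle.E n → ℝ) (hv : v ∈ ThinObstacle.admissible Ω M φ ψ)
    (g : ThinObstacle.E n → ℝ) (hg : ThinObstacle.IsTrace Ω (M ∩ Ω) v g)
    (lam : ThinObstacle.E n → ℝ) (hlam : lam ∈ ThinObstacle.multipliers Ω M)
    (y : ThinObstacle.E n → ThinObstacle.E n) (hy : y ∈ ThinObstacle.dualFields Ω M lam) :
    ENNReal.ofReal (ThinObstacle.normSq Ω (ThinObstacle.weakGrad Ω (v - u))) ≤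
      ENNReal.ofReal (ThinObstacle.normSq Ω (ThinObstacle.weakGrad Ω v - y)) +
        2 * ∫⁻ x, ENNReal.ofReal (lam x * (g x - ψ x)) ∂(ThinObstacle.surf (M ∩ Ω)) ∧
    (MemLp ψ 2 (ThinObstacle.surf (M ∩ Ω)) →
      Integrable (fun x => lam x * (g x - ψ x)) (ThinObstacle.surf (M ∩ Ω)) ∧
      ThinObstacle.normSq Ω (ThinObstacle.weakGrad Ω (v - u)) ≤
        ThinObstacle.normSq Ω (ThinObstacle.weakGrad Ω v - y) +
          2 * ∫ x, lam x * (g x - ψ x) ∂(ThinObstacle.surf (M ∩ Ω))) := by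
  obtain ⟨gu, hgu, hψu⟩ := hu.1.2.2
  have hmain := hu.normSq_weakGrad_sub_le hΩ.isOpen hv hg hgu hy
  have hle : ∀ᵐ x ∂(ThinObstacle.surf (M ∩ Ω)), lam x * (g x - gu x) ≤ lam x * (g x - ψ x) := by
    filter_upwards [hψu, hlam.2] with x h₁ h₂
    exact mul_le_mul_of_nonneg_left (sub_le_sub_left h₁ _) h₂
  have hint : Integrable (fun x => lam x * (g x - gu x)) (ThinObstacle.surf (M ∩ Ω)) :=
    hlam.1.integrable_mul (hg.1.sub hgu.1)
  refine ⟨?_, fun hψ2 => ?_⟩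
  · refine (ENNReal.ofReal_le_ofReal hmain).trans (ENNReal.ofReal_add_le.trans ?_)
    refine add_le_add le_rfl ?_
    rw [ENNReal.ofReal_mul zero_le_two, ENNReal.ofReal_ofNat]
    refine mul_le_mul_right ?_ 2
    -- `λ (g - gu)` may change sign, so its positive part is used to pass to the lower integral;
    -- that part is at most `ENNReal.ofReal` of `λ (g - ψ)`, with no integrability of `ψ` needed.
    refine (ENNReal.ofReal_le_ofReal (integral_mono hint hint.pos_part fun x =>
      le_max_left _ _)).trans ?_
    rw [ofReal_integral_eq_lintegral_ofReal hint.pos_part (.of_forall fun x => le_max_right _ _)]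
    refine lintegral_mono_ae ?_
    filter_upwards [hle] with x hx
    rw [ENNReal.ofReal_max, ENNReal.ofReal_zero, max_eq_left zero_le]
    exact ENNReal.ofReal_le_ofReal hx
  · have hint' : Integrable (fun x => lam x * (g x - ψ x)) (ThinObstacle.surf (M ∩ Ω)) :=
      hlam.1.integrable_mul (hg.1.sub hψ2)
    refine ⟨hint', hmain.trans ?_⟩
    linarith [integral_mono_ae hint hint' hle]
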